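/- Consider the general (real, Gaussian) Y-channel: three users communicate in full duplex through a relay, with channel coefficients $h_1,h_2,h_3\in\mathbb{R}$, user power $P$ and relay power $P_r$. For every ordered pair $(j,k)$ of distinct users, user $j$ has a message $m_{jk}$ for user $k$; the six messages are independent, $m_{jk}$ being uniform on $\{1,\dots,\lfloor 2^{nR_{jk}}\rfloor\}$. For distinct $j,k,l$ and at times $i=1,\dots,n$, user $j$ sends $X_{ji}=f_{j,i}(m_{jk},m_{jl},Y_j^{i-1})$ and the relay sends $X_{ri}=f_{r,i}(Y_r^{i-1})$, where $$Y_{ri}=h_1X_{1i}+h_2X_{2i}+h_3X_{3i}+Z_{ri},\qquad Y_{ji}=h_jX_{ri}+Z_{ji},$$ all noise variables $Z_{ri},Z_{ji}$ are independent, $\mathcal{N}(0,1)$-distributed and independent of the messages, and $$\frac1n\sum_{i=1}^n\mathbb{E}[X_{ji}^2]\le P\quad(j=1,2,3),\qquad \frac1n\sum_{i=1}^n\mathbb{E}[X_{ri}^2]\le P_r .$$ User $j$ decodes $(\hat m_{kj},\hat m_{lj})=g_j(Y_j^n,m_{jk},m_{jl})$. A rate tuple $(R_{12},R_{13},R_{21},R_{23},R_{31},R_{32})\in\mathbb{R}_+^6$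 is achievable if there is a sequence of such codes, one for each length $n$, for which the probability that some message is decoded incorrectly tends to $0$ as $n\to\infty$. Then every achievable rate tuple of the general Y-channel satisfies $$R_{kj}+R_{lj}+R_{kl}\le C\big((|h_k|+|h_l|)^2P\big),\qquad C(x)=\tfrac12\log_2(1+x),$$ for all distinct $j,k,l\in\{1,2,3\}$. -/

import Mathlib

open MeasureTheory ProbabilityTheory Filter Topology

namespace YChannel

/-- The ordered pairs `(j, k)` of distinct users: `(j, k)` carries the message from `j` to `k`. -/
abbrev Link : Type := {p : Fin 3 × Fin 3 // p.1 ≠ p.2}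

/-- The link from user `j` to user `k`. -/
abbrev link (j k : Fin 3) (hjk : j ≠ k) : Link := ⟨(j, k), hjk⟩

/-- The number of elements of the message set `{1, …, 2 ^ (n R_p)}`, that is, of the positive
integers that are at most `2 ^ (n R_p)`. -/
noncomputable def messageCount (R : Link → ℝ) (n : ℕ) (p : Link) : ℕ :=
  ⌊(2 : ℝ) ^ ((n : ℝ) * R p)⌋₊

/-- The six messages. -/
abbrev Messages (R : Link → ℝ) (n : ℕ) : Type := (p : Link) → Fin (messageCount R n p)

/-- The pair of messages that user `j` sends. -/
abbrev OutMessages (R : Link → ℝ) (n : ℕ) (j : Fin 3) : Type :=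
  (k : {k : Fin 3 // k ≠ j}) → Fin (messageCount R n (link j k k.2.symm))

/-- The pair of messages intended for user `j`. -/
abbrev InMessages (R : Link → ℝ) (n : ℕ) (j : Fin 3) : Type :=
  (k : {k : Fin 3 // k ≠ j}) → Fin (messageCount R n (link k j k.2))

/-- The messages, among all six, that user `j` sends. -/
def outgoing {R : Link → ℝ} {n : ℕ} (m : Messages R n) (j : Fin 3) : OutMessages R n j :=
  fun k => m (link j k k.2.symm)

/-- The messages, among all six, that are intended for user `j`. -/
def incoming {R : Link → ℝ} {n : ℕ} (m : Messages R n) (j : Fin 3) : InMessages R n j :=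
  fun k => m (link k j k.2)

/-- A code of length `n` at rates `R` for the general Y-channel. At time `i` (times are
`0, …, n - 1`) user `j` sends a function of its two messages and of the symbols it received at the
times before `i`, and the relay sends a function of the symbols it received before `i`. After the
last symbol each user decodes from its received sequence and its own messages. -/
structure Code (R : Link → ℝ) (n : ℕ) where
  enc : (j : Fin 3) → (i : Fin n) → OutMessages R n j → (Fin (i : ℕ) → ℝ) → ℝ
  relay : (i : Fin n) → (Fin (i : ℕ) → ℝ) → ℝ
  dec : (j : Fin 3) → (Fin n → ℝ) → OutMessages R n j → InMessages R n j
  measurable_enc : ∀ j i w, Measurable (enc j i w)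
  measurable_relay : ∀ i, Measurable (relay i)
  measurable_dec : ∀ j w, Measurable (fun y => dec j y w)

/-- The noise sequences: of the relay (first component) and of the three users (second). -/
abbrev Noise (n : ℕ) : Type := (Fin n → ℝ) × (Fin 3 → Fin n → ℝ)

/-- All noise variables are independent standard Gaussians. -/
noncomputable def noiseMeasure (n : ℕ) : Measure (Noise n) :=
  (Measure.pi fun _ => gaussianReal 0 1).prod
    (Measure.pi fun _ => Measure.pi fun _ => gaussianReal 0 1)

/-- The joint law of the messages and the noise: the messages are uniformly distributed (hence
independent of each other) and independent of the noise. -/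
noncomputable def jointMeasure (R : Link → ℝ) (n : ℕ) : Measure (Messages R n × Noise n) :=
  (uniformOn (Set.univ : Set (Messages R n))).prod (noiseMeasure n)

namespace Code

variable {R : Link → ℝ} {n : ℕ}

/-- The symbols received at time `i`, by the relay (first component,
`y_{r i} = ∑ j, h_j x_{j i} + z_{r i}`) and by each user `j` (second component,
`y_{j i} = h_j x_{r i} + z_{j i}`). -/
noncomputable def received (c : Code R n) (h : Fin 3 → ℝ) (ω : Messages R n × Noise n)
    (i : Fin n) : ℝ × (Fin 3 → ℝ) :=
  (∑ j, h j * c.enc j i (outgoing ω.1 j)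
      (fun t => (c.received h ω ⟨t, t.isLt.trans i.isLt⟩).2 j) + ω.2.1 i,
    fun j => h j * c.relay i
      (fun t => (c.received h ω ⟨t, t.isLt.trans i.isLt⟩).1) + ω.2.2 j i)
termination_by (i : ℕ)
decreasing_by all_goals exact t.isLt

/-- The symbol `X_{j i}` that user `j` sends at time `i`. -/
noncomputable def userInput (c : Code R n) (h : Fin 3 → ℝ) (j : Fin 3) (i : Fin n)
    (ω : Messages R n × Noise n) : ℝ :=
  c.enc j i (outgoing ω.1 j) (fun t => (c.received h ω ⟨t, t.isLt.trans i.isLt⟩).2 j)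

/-- The symbol `X_{r i}` that the relay sends at time `i`. -/
noncomputable def relayInput (c : Code R n) (h : Fin 3 → ℝ) (i : Fin n)
    (ω : Messages R n × Noise n) : ℝ :=
  c.relay i (fun t => (c.received h ω ⟨t, t.isLt.trans i.isLt⟩).1)

/-- The average power constraints, `P` at each user and `Pr` at the relay. The second moments are
required to be finite. -/
def SatisfiesPower (c : Code R n) (h : Fin 3 → ℝ) (P Pr : ℝ) : Prop :=
  (∀ j, (∀ i, Integrable (fun ω => c.userInput h j i ω ^ 2) (jointMeasure R n)) ∧
    (1 / (n : ℝ)) * ∑ i, ∫ ω, c.userInput h j i ω ^ 2 ∂(jointMeasure R n) ≤ P) ∧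
  (∀ i, Integrable (fun ω => c.relayInput h i ω ^ 2) (jointMeasure R n)) ∧
    (1 / (n : ℝ)) * ∑ i, ∫ ω, c.relayInput h i ω ^ 2 ∂(jointMeasure R n) ≤ Pr

/-- The event that some user decodes one of the messages intended for it incorrectly. -/
def errorEvent (c : Code R n) (h : Fin 3 → ℝ) : Set (Messages R n × Noise n) :=
  {ω | ∃ j, c.dec j (fun i => (c.received h ω i).2 j) (outgoing ω.1 j) ≠ incoming ω.1 j}

/-- The average error probability. -/
noncomputable def errorProb (c : Code R n) (h : Fin 3 → ℝ) : ℝ :=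
  (jointMeasure R n).real (c.errorEvent h)

end Code

/-- The capacity region of the general Y-channel: the achievable rate tuples. -/
def capacityRegion (h : Fin 3 → ℝ) (P Pr : ℝ) : Set (Link → ℝ) :=
  {R | (∀ p, 0 ≤ R p) ∧ ∃ c : (n : ℕ) → Code R n,
    (∀ n, (c n).SatisfiesPower h P Pr) ∧ Tendsto (fun n => (c n).errorProb h) atTop (𝓝 0)}

/-- The function `C(x) = (1/2) log (1 + x)`, in bits. -/
noncomputable def gaussianC (x : ℝ) : ℝ := 1 / 2 * Real.logb 2 (1 + x)

end YChannel

open scoped ENNReal NNReal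

namespace YChannel

/-! ### Densities of product Gaussian measures -/

section Gaussian

/-! A genie argument, made quantitative by a change of measure. The sequence `y` received by the
relay and the users' noise determine what every user receives. With its own messages, user `j`
therefore decodes `m_kj` and `m_lj`. Told `m_lk` as well, it knows all messages of user `l`, can run
the decoder of `l`, and finds `m_kl`. So three messages, with `M` joint values, are recovered from
`y`, the users' noise and the other three messages (`messages_eq_of_decoded`).

Compare the true law with a reference law under which, given the messages and the users' noise, the
variables `y_i - h_j x_ji` are i.i.d. `N(0, v)`, where `v = 1 + (|h_k| + |h_l|)^2 P`. There `y`
depends on the messages only through those that user `j` sends, so the three messages are recovered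
with probability at most `1/M` (`sum_lintegral_comp_mul_exp_neg_logRatio_le`).

The Gibbs inequality (`measureReal_mul_log_le`) bounds the true probability of correct decoding
times `log M` by the mean log-likelihood ratio plus `1`. The power constraint bounds that mean by
`(n/2) log v` (`integral_logLikelihood_le`). Division by `n` and `n → ∞` finish the proof. -/

theorem lintegral_fin_prod_eq_prod {n : ℕ} (μ : Fin n → Measure ℝ) [∀ i, SigmaFinite (μ i)]
    (f : Fin n → ℝ → ℝ≥0∞) (hf : ∀ i, Measurable (f i)) :
    ∫⁻ x, ∏ i, f i (x i) ∂(Measure.pi μ) = ∏ i, ∫⁻ x, f i x ∂(μ i) := by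
  induction n with
  | zero => simp
  | succ n ih =>
    have hmp := measurePreserving_piFinSuccAbove μ 0
    have hcons : ∀ x : Fin (n + 1) → ℝ, ∏ i, f i (x i)
        = (fun p : ℝ × (Fin n → ℝ) => f 0 p.1 * ∏ i : Fin n, f i.succ (p.2 i))
          (MeasurableEquiv.piFinSuccAbove (fun _ => ℝ) 0 x) := fun x => Fin.prod_univ_succ _
    simp_rw [hcons]
    rw [hmp.lintegral_comp_emb (MeasurableEquiv.measurableEmbedding _)
        (fun p : ℝ × (Fin n → ℝ) => f 0 p.1 * ∏ i : Fin n, f i.succ (p.2 i)),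
      lintegral_prod_mul (f := fun x => f 0 x)
        (g := fun y : Fin n → ℝ => ∏ i : Fin n, f i.succ (y i)) (hf 0).aemeasurable
        (Finset.measurable_prod _ fun i _ =>
          (hf i.succ).comp (measurable_pi_apply i)).aemeasurable, Fin.prod_univ_succ]
    congr 1
    exact ih (fun i => μ i.succ) (fun i => f i.succ) fun i => hf i.succ

theorem pi_gaussianReal_eq_withDensity (n : ℕ) {v : ℝ≥0} (hv : v ≠ 0) :
    (Measure.pi fun _ : Fin n => gaussianReal 0 v)
      = (volume : Measure (Fin n → ℝ)).withDensity fun x => ∏ i, gaussianPDF 0 v (x i) := by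
  refine Measure.pi_eq fun s hs => ?_
  rw [withDensity_apply _ (MeasurableSet.univ_pi hs), ← lintegral_indicator (MeasurableSet.univ_pi hs)]
  have : ∀ x : Fin n → ℝ, (Set.univ.pi s).indicator (fun x => ∏ i, gaussianPDF 0 v (x i)) x
      = ∏ i, (s i).indicator (gaussianPDF 0 v) (x i) := by
    intro x
    by_cases hx : x ∈ Set.univ.pi s
    · rw [Set.indicator_of_mem hx]
      exact Finset.prod_congr rfl fun i _ =>
        (Set.indicator_of_mem (hx i (Set.mem_univ i)) _).symm
    · rw [Set.indicator_of_notMem hx]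
      simp only [Set.mem_univ_pi, not_forall] at hx
      obtain ⟨i, hi⟩ := hx
      exact (Finset.prod_eq_zero (Finset.mem_univ i) (Set.indicator_of_notMem hi _)).symm
  simp_rw [this]
  rw [volume_pi, lintegral_fin_prod_eq_prod _ _ fun i => (measurable_gaussianPDF 0 v).indicator (hs i)]
  refine Finset.prod_congr rfl fun i _ => ?_
  rw [lintegral_indicator (hs i), gaussianReal_apply 0 hv]

theorem lintegral_pi_gaussianReal (n : ℕ) {v : ℝ≥0} (hv : v ≠ 0) {f : (Fin n → ℝ) → ℝ≥0∞}
    (hf : Measurable f) :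
    ∫⁻ x, f x ∂(Measure.pi fun _ : Fin n => gaussianReal 0 v)
      = ∫⁻ x, (∏ i, gaussianPDF 0 v (x i)) * f x := by
  have hm : Measurable fun x : Fin n → ℝ => ∏ i, gaussianPDF 0 v (x i) :=
    Finset.measurable_prod _ fun i _ =>
      (measurable_gaussianPDF 0 v).comp (measurable_pi_apply i)
  rw [pi_gaussianReal_eq_withDensity n hv, lintegral_withDensity_eq_lintegral_mul _ hm hf]
  rfl

end Gaussian

/-! ### Triangular changes of variables -/

section Shear

/-- Subtraction from each coordinate of a function of the earlier coordinates. -/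
def shear {n : ℕ} (a : (i : Fin n) → (Fin (i : ℕ) → ℝ) → ℝ) (y : Fin n → ℝ) : Fin n → ℝ :=
  fun i => y i - a i fun t => y ⟨t, t.isLt.trans i.isLt⟩

theorem measurable_shear {n : ℕ} {a : (i : Fin n) → (Fin (i : ℕ) → ℝ) → ℝ}
    (ha : ∀ i, Measurable (a i)) : Measurable (shear a) :=
  measurable_pi_lambda _ fun i => (measurable_pi_apply i).sub
    ((ha i).comp (measurable_pi_lambda _ fun _ => measurable_pi_apply _))

theorem shear_injective {n : ℕ} (a : (i : Fin n) → (Fin (i : ℕ) → ℝ) → ℝ) :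
    Function.Injective (shear a) := by
  intro x y hxy
  have key : ∀ m (hm : m < n), x ⟨m, hm⟩ = y ⟨m, hm⟩ := by
    intro m
    induction m using Nat.strong_induction_on with
    | _ m ih =>
      intro hm
      have h1 := congrFun hxy ⟨m, hm⟩
      have h2 : (fun t : Fin m => x ⟨t, t.isLt.trans hm⟩) = fun t : Fin m => y ⟨t, t.isLt.trans hm⟩ :=
        funext fun t => ih t t.isLt _
      simp only [shear, h2] at h1
      linarith
  exact funext fun i => key i i.isLt

/-- The map is triangular with unit diagonal. Peeling off the last coordinate exhibits it as a skew
product whose fibre maps are translations. -/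
theorem measurePreserving_shear {n : ℕ} {a : (i : Fin n) → (Fin (i : ℕ) → ℝ) → ℝ}
    (ha : ∀ i, Measurable (a i)) :
    MeasurePreserving (shear a) (volume : Measure (Fin n → ℝ)) volume := by
  induction n with
  | zero =>
    have : shear a = id := funext fun _ => Subsingleton.elim _ _
    rw [this]
    exact MeasurePreserving.id _
  | succ n ih =>
    let e := MeasurableEquiv.piFinSuccAbove (fun _ : Fin (n + 1) => ℝ) (Fin.last n)
    have he : MeasurePreserving e volume volume :=
      volume_preserving_piFinSuccAbove (fun _ : Fin (n + 1) => ℝ) (Fin.last n)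
    have hb := ih (a := fun i => a i.castSucc) fun i => ha i.castSucc
    have hsk : MeasurePreserving
        (fun p : (Fin n → ℝ) × ℝ => (shear (fun i => a i.castSucc) p.1, p.2 - a (Fin.last n) p.1))
        ((volume : Measure (Fin n → ℝ)).prod volume) ((volume : Measure (Fin n → ℝ)).prod volume) :=
      hb.skew_product (g := fun x y => y - a (Fin.last n) x)
        (measurable_snd.sub ((ha (Fin.last n)).comp measurable_fst))
        (ae_of_all _ fun x => (measurePreserving_sub_right volume _).map_eq)
    have hsw : MeasurePreserving Prod.swap ((volume : Measure (Fin n → ℝ)).prod (volume : Measure ℝ))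
      (volume.prod volume) := Measure.measurePreserving_swap
    have hsw' : MeasurePreserving Prod.swap ((volume : Measure ℝ).prod (volume : Measure (Fin n → ℝ)))
      (volume.prod volume) := Measure.measurePreserving_swap
    have htot := (he.symm e).comp (hsw.comp (hsk.comp (hsw'.comp he)))
    convert! htot using 1
    funext y
    apply e.injective
    simp only [Function.comp, MeasurableEquiv.apply_symm_apply]
    refine Prod.ext ?_ (funext fun i => ?_)
    · simp [e, shear, MeasurableEquiv.piFinSuccAbove, Fin.insertNthEquiv]
      rfl
    · simp [e, shear, MeasurableEquiv.piFinSuccAbove, Fin.insertNthEquiv]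
      rfl

end Shear

/-! ### Change of measure and the Gibbs inequality -/

section ChangeOfMeasure

/-- The logarithm of the ratio at `z` of the standard Gaussian density to the density at `w` of the
centred Gaussian of variance `v`. -/
noncomputable def logRatio (v : ℝ≥0) (z w : ℝ) : ℝ :=
  -z ^ 2 / 2 + 1 / 2 * Real.log v + w ^ 2 / (2 * v)

theorem gaussianPDF_mul_exp_neg_logRatio {v : ℝ≥0} (hv : v ≠ 0) (z w : ℝ) :
    gaussianPDF 0 1 z * ENNReal.ofReal (Real.exp (-logRatio v z w)) = gaussianPDF 0 v w := by
  have hv' : (0 : ℝ) < v := by positivity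
  rw [gaussianPDF, gaussianPDF, ← ENNReal.ofReal_mul (gaussianPDFReal_nonneg _ _ _)]
  congr 1
  have hsq : Real.sqrt (2 * Real.pi * v) = Real.sqrt (2 * Real.pi) * Real.exp (1 / 2 * Real.log v) := by
    rw [Real.sqrt_mul (by positivity), Real.sqrt_eq_rpow (v : ℝ), Real.rpow_def_of_pos hv',
      mul_comm (Real.log _)]
  simp only [gaussianPDFReal, NNReal.coe_one, mul_one, sub_zero, logRatio, hsq, mul_inv,
    ← Real.exp_neg]
  rw [mul_assoc, mul_assoc, ← Real.exp_add, ← Real.exp_add]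
  congr 2
  ring

/-- In the application `z` is the relay noise, `S z` the sequence received by the relay, `a` the
total signal and `b` the signal of user `j`. The substitution `z = shear a y` inverts `S` and has no
Jacobian, even though the signals depend on the past of `y`. The exponential weight then exchanges
the two Gaussian densities. -/
theorem lintegral_comp_mul_exp_neg_logRatio {n : ℕ} {v : ℝ≥0} (hv : v ≠ 0)
    {a b : (i : Fin n) → (Fin (i : ℕ) → ℝ) → ℝ} (ha : ∀ i, Measurable (a i))
    (hb : ∀ i, Measurable (b i)) {S : (Fin n → ℝ) → Fin n → ℝ} (hS : Measurable S)
    (haS : ∀ z, shear a (S z) = z) {F : (Fin n → ℝ) → ℝ≥0∞} (hF : Measurable F) :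
    ∫⁻ z, F (S z) * ENNReal.ofReal (Real.exp (-∑ i, logRatio v (z i) (shear b (S z) i)))
        ∂(Measure.pi fun _ : Fin n => gaussianReal 0 1)
      = ∫⁻ y, F y * ∏ i, gaussianPDF 0 v (shear b y i) := by
  have hSa : ∀ y, S (shear a y) = y := fun y => shear_injective a (haS _)
  have hG : Measurable fun y : Fin n → ℝ => F y * ∏ i, gaussianPDF 0 v (shear b y i) :=
    hF.mul (Finset.measurable_prod _ fun i _ =>
      (measurable_gaussianPDF 0 v).comp ((measurable_pi_apply i).comp (measurable_shear hb)))
  have hL : Measurable fun z : Fin n → ℝ => ∑ i, logRatio v (z i) (shear b (S z) i) := by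
    refine Finset.measurable_sum _ fun i _ => ?_
    have h1 : Measurable fun z : Fin n → ℝ => shear b (S z) i :=
      (measurable_pi_apply i).comp ((measurable_shear hb).comp hS)
    unfold logRatio
    fun_prop
  have hFL : Measurable fun z : Fin n → ℝ =>
      F (S z) * ENNReal.ofReal (Real.exp (-∑ i, logRatio v (z i) (shear b (S z) i))) :=
    (hF.comp hS).mul (Real.measurable_exp.comp hL.neg).ennreal_ofReal
  rw [lintegral_pi_gaussianReal n one_ne_zero hFL]
  have hpt : ∀ z : Fin n → ℝ, (∏ i, gaussianPDF 0 1 (z i)) * (F (S z) *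
      ENNReal.ofReal (Real.exp (-∑ i, logRatio v (z i) (shear b (S z) i))))
      = F (S z) * ∏ i, gaussianPDF 0 v (shear b (S z) i) := by
    intro z
    rw [← Finset.sum_neg_distrib, Real.exp_sum,
      ENNReal.ofReal_prod_of_nonneg fun i _ => (Real.exp_pos _).le, mul_left_comm,
      ← Finset.prod_mul_distrib]
    simp_rw [gaussianPDF_mul_exp_neg_logRatio hv]
  simp_rw [hpt]
  have hcomp := (measurePreserving_shear ha).lintegral_comp (hG.comp hS)
  simp only [Function.comp, hSa] at hcomp
  exact hcomp.symm

theorem lintegral_prod_gaussianPDF_shear {n : ℕ} {v : ℝ≥0} (hv : v ≠ 0)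
    {b : (i : Fin n) → (Fin (i : ℕ) → ℝ) → ℝ} (hb : ∀ i, Measurable (b i)) :
    ∫⁻ y : Fin n → ℝ, ∏ i, gaussianPDF 0 v (shear b y i) = 1 := by
  rw [(measurePreserving_shear hb).lintegral_comp
    (f := fun y : Fin n → ℝ => ∏ i, gaussianPDF 0 v (y i)) (Finset.measurable_prod _ fun i _ =>
      (measurable_gaussianPDF 0 v).comp (measurable_pi_apply i)), volume_pi,
    lintegral_fin_prod_eq_prod _ _ fun _ => measurable_gaussianPDF 0 v]
  simp [lintegral_gaussianPDF_eq_one 0 hv]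

/-- If `b` depends on the index `m` only through `s m`, and the weights `F m y` with the same `s m`
have sum at most `1`, then the total weight under the changed measures is at most the number of
values of `s`. -/
theorem sum_lintegral_comp_mul_exp_neg_logRatio_le {ι σ : Type*} [Fintype ι] [Fintype σ]
    [DecidableEq σ] {n : ℕ} {v : ℝ≥0} (hv : v ≠ 0) (s : ι → σ)
    {a : ι → (i : Fin n) → (Fin (i : ℕ) → ℝ) → ℝ} {b : σ → (i : Fin n) → (Fin (i : ℕ) → ℝ) → ℝ}
    (ha : ∀ m i, Measurable (a m i)) (hb : ∀ t i, Measurable (b t i))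
    {S : ι → (Fin n → ℝ) → Fin n → ℝ} (hS : ∀ m, Measurable (S m))
    (haS : ∀ m z, shear (a m) (S m z) = z) {F : ι → (Fin n → ℝ) → ℝ≥0∞}
    (hF : ∀ m, Measurable (F m)) (hF1 : ∀ t y, ∑ m with s m = t, F m y ≤ 1) :
    ∑ m, ∫⁻ z, F m (S m z) *
        ENNReal.ofReal (Real.exp (-∑ i, logRatio v (z i) (shear (b (s m)) (S m z) i)))
        ∂(Measure.pi fun _ : Fin n => gaussianReal 0 1)
      ≤ Fintype.card σ := by
  have hq : ∀ t, Measurable fun y : Fin n → ℝ => ∏ i, gaussianPDF 0 v (shear (b t) y i) :=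
    fun t => Finset.measurable_prod _ fun i _ =>
      (measurable_gaussianPDF 0 v).comp ((measurable_pi_apply i).comp (measurable_shear (hb t)))
  calc _ = ∑ m, ∫⁻ y, F m y * ∏ i, gaussianPDF 0 v (shear (b (s m)) y i) :=
        Finset.sum_congr rfl fun m _ =>
          lintegral_comp_mul_exp_neg_logRatio hv (ha m) (hb (s m)) (hS m) (haS m) (hF m)
    _ = ∫⁻ y, ∑ m, F m y * ∏ i, gaussianPDF 0 v (shear (b (s m)) y i) :=
        (lintegral_finsetSum _ fun m _ => (hF m).mul (hq (s m))).symm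
    _ ≤ ∫⁻ y, ∑ t, ∏ i, gaussianPDF 0 v (shear (b t) y i) := by
        refine lintegral_mono fun y => ?_
        rw [← Finset.sum_fiberwise Finset.univ s]
        refine Finset.sum_le_sum fun t _ => ?_
        calc _ = (∑ m with s m = t, F m y) * ∏ i, gaussianPDF 0 v (shear (b t) y i) := by
              rw [Finset.sum_mul]
              refine Finset.sum_congr rfl fun m hm => ?_
              rw [(Finset.mem_filter.1 hm).2]
          _ ≤ _ := mul_le_of_le_one_left zero_le (hF1 t y)
    _ = ∑ t : σ, ∫⁻ y : Fin n → ℝ, ∏ i, gaussianPDF 0 v (shear (b t) y i) :=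
        lintegral_finsetSum _ fun t _ => hq t
    _ = _ := by simp [lintegral_prod_gaussianPDF_shear hv (hb _)]

/-- The Gibbs inequality for an event whose probability is divided by `M` by a change of measure
with log-likelihood ratio `L`. -/
theorem measureReal_mul_log_le {Ω : Type*} [MeasurableSpace Ω] {μ : Measure Ω}
    [IsProbabilityMeasure μ] {L : Ω → ℝ} (hL : Integrable L μ) {A : Set Ω} (hA : MeasurableSet A)
    {M : ℝ} (hM : 1 ≤ M) (h1 : ∫⁻ ω, ENNReal.ofReal (Real.exp (-L ω)) ∂μ ≤ 1)
    (h2 : ∫⁻ ω, A.indicator 1 ω * ENNReal.ofReal (Real.exp (-L ω)) ∂μ ≤ ENNReal.ofReal M⁻¹) :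
    μ.real A * Real.log M ≤ ∫ ω, L ω ∂μ + 1 := by
  have hM0 : 0 < M := by linarith
  have hexp : AEMeasurable (fun ω => ENNReal.ofReal (Real.exp (-L ω))) μ :=
    (Real.measurable_exp.comp_aemeasurable hL.aemeasurable.neg).ennreal_ofReal
  -- The weight `exp g` is `M` on `A` and `1` elsewhere, so `exp (g - L)` has mean at most `1 + M *
  -- M⁻¹ = 2`. With `x + 1 ≤ exp x` this gives the bound; the excess of `2` over `1` is the additive
  -- `1`.
  let g : Ω → ℝ := A.indicator fun _ => Real.log M
  have hg : Integrable g μ := (integrable_const _).indicator hA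
  have hgL : Integrable (fun ω => g ω - L ω) μ := hg.sub hL
  have hlin : ∫⁻ ω, ENNReal.ofReal (Real.exp (g ω - L ω)) ∂μ ≤ 2 := by
    calc _ ≤ ∫⁻ ω, (ENNReal.ofReal (Real.exp (-L ω)) + ENNReal.ofReal M *
            (A.indicator 1 ω * ENNReal.ofReal (Real.exp (-L ω)))) ∂μ := by
          refine lintegral_mono fun ω => ?_
          by_cases hω : ω ∈ A
          · simp only [g, Set.indicator_of_mem hω, Pi.one_apply, one_mul]
            refine le_add_left ?_
            rw [← ENNReal.ofReal_mul hM0.le, sub_eq_add_neg, Real.exp_add, Real.exp_log hM0]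
          · simp [g, Set.indicator_of_notMem hω]
      _ = ∫⁻ ω, ENNReal.ofReal (Real.exp (-L ω)) ∂μ + ENNReal.ofReal M *
            ∫⁻ ω, A.indicator 1 ω * ENNReal.ofReal (Real.exp (-L ω)) ∂μ := by
          rw [lintegral_add_left' hexp, lintegral_const_mul' _ _ ENNReal.ofReal_ne_top]
      _ ≤ 1 + ENNReal.ofReal M * ENNReal.ofReal M⁻¹ := by gcongr
      _ = 2 := by
          rw [← ENNReal.ofReal_mul hM0.le, mul_inv_cancel₀ hM0.ne', ENNReal.ofReal_one]
          norm_num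
  have hmeas : AEStronglyMeasurable (fun ω => Real.exp (g ω - L ω)) μ :=
    (Real.measurable_exp.comp_aemeasurable hgL.aemeasurable).aestronglyMeasurable
  have hint : Integrable (fun ω => Real.exp (g ω - L ω)) μ :=
    (lintegral_ofReal_ne_top_iff_integrable hmeas (ae_of_all _ fun ω => (Real.exp_pos _).le)).1
      (hlin.trans_lt (by norm_num)).ne
  have hle2 : ∫ ω, Real.exp (g ω - L ω) ∂μ ≤ 2 := by
    rw [integral_eq_lintegral_of_nonneg_ae (ae_of_all _ fun ω => (Real.exp_pos _).le) hmeas]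
    exact ENNReal.toReal_le_of_le_ofReal (by norm_num) (by simpa using hlin)
  have hle : ∫ ω, (g ω - L ω + 1) ∂μ ≤ ∫ ω, Real.exp (g ω - L ω) ∂μ :=
    integral_mono (hgL.add (integrable_const 1)) hint fun ω => Real.add_one_le_exp _
  have hgi : ∫ ω, g ω ∂μ = μ.real A * Real.log M := by
    simp only [g]
    rw [integral_indicator_const _ hA, smul_eq_mul]
  rw [integral_add hgL (integrable_const 1), integral_sub hg hL, hgi] at hle
  simp at hle
  linarith

end ChangeOfMeasure

namespace Code

variable {R : Link → ℝ} {n : ℕ}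

/-! ### Replaying the channel from the relay's observations -/

section Replay

/-- The sequence received by the relay. -/
noncomputable def relayReceived (c : Code R n) (h : Fin 3 → ℝ) (ω : Messages R n × Noise n) :
    Fin n → ℝ :=
  fun i => (c.received h ω i).1

/-- The symbol that user `j`, with messages `w`, sends at time `i`, as a function of the noise of
the users and of the symbols that the relay received before. -/
noncomputable def inputOf (c : Code R n) (h : Fin 3 → ℝ) (j : Fin 3) (w : OutMessages R n j)
    (zU : Fin 3 → Fin n → ℝ) (i : Fin n) (p : Fin (i : ℕ) → ℝ) : ℝ :=
  c.enc j i w fun t => h j * c.relay ⟨t, t.isLt.trans i.isLt⟩ (fun s => p ⟨s, s.isLt.trans t.isLt⟩)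
    + zU j ⟨t, t.isLt.trans i.isLt⟩

/-- The noiseless symbol that reaches the relay at time `i`, as a function of the messages, of the
noise of the users and of the symbols that the relay received before. -/
noncomputable def relaySignal (c : Code R n) (h : Fin 3 → ℝ) (m : Messages R n)
    (zU : Fin 3 → Fin n → ℝ) (i : Fin n) (p : Fin (i : ℕ) → ℝ) : ℝ :=
  ∑ j, h j * c.inputOf h j (outgoing m j) zU i p

/-- The sequence that user `j` receives if the relay receives `y`. -/
noncomputable def userReceived (c : Code R n) (h : Fin 3 → ℝ) (j : Fin 3)
    (zU : Fin 3 → Fin n → ℝ) (y : Fin n → ℝ) (i : Fin n) : ℝ :=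
  h j * c.relay i (fun t => y ⟨t, t.isLt.trans i.isLt⟩) + zU j i

/-- The relay sends functions of its own past observations, so its sequence and the noise of the
users suffice to run every decoder. -/
theorem received_snd (c : Code R n) (h : Fin 3 → ℝ) (ω : Messages R n × Noise n) (i : Fin n)
    (j : Fin 3) : (c.received h ω i).2 j = c.userReceived h j ω.2.2 (c.relayReceived h ω) i := by
  rw [received]
  rfl

theorem userInput_eq_inputOf (c : Code R n) (h : Fin 3 → ℝ) (j : Fin 3) (i : Fin n)
    (ω : Messages R n × Noise n) :
    c.userInput h j i ω = c.inputOf h j (outgoing ω.1 j) ω.2.2 i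
      fun t => c.relayReceived h ω ⟨t, t.isLt.trans i.isLt⟩ := by
  simp only [userInput, received_snd]
  rfl

theorem relayReceived_eq (c : Code R n) (h : Fin 3 → ℝ) (ω : Messages R n × Noise n) (i : Fin n) :
    c.relayReceived h ω i = ∑ j, h j * c.userInput h j i ω + ω.2.1 i := by
  rw [relayReceived, received]
  rfl

/-- This identifies `relayReceived` as the map `S` of the change of variables, for fixed messages
and users' noise. -/
theorem shear_relaySignal (c : Code R n) (h : Fin 3 → ℝ) (ω : Messages R n × Noise n) :
    shear (c.relaySignal h ω.1 ω.2.2) (c.relayReceived h ω) = ω.2.1 := by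
  funext i
  simp only [shear, relaySignal, ← userInput_eq_inputOf]
  rw [relayReceived_eq]
  ring

/-- What remains after removing only the signal of user `j` is the part that the reference law
replaces by `N(0, v)` noise. -/
theorem shear_inputOf (c : Code R n) (h : Fin 3 → ℝ) (ω : Messages R n × Noise n)
    {j k l : Fin 3} (hkj : k ≠ j) (hlj : l ≠ j) (hkl : k ≠ l) (i : Fin n) :
    shear (fun i p => h j * c.inputOf h j (outgoing ω.1 j) ω.2.2 i p) (c.relayReceived h ω) i
      = h k * c.userInput h k i ω + h l * c.userInput h l i ω + ω.2.1 i := by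
  have huniv : (Finset.univ : Finset (Fin 3)) = {j, k, l} := by
    revert j k l
    decide
  simp only [shear, ← userInput_eq_inputOf]
  rw [relayReceived_eq, huniv, Finset.sum_insert (by simp [hkj.symm, hlj.symm]),
    Finset.sum_pair hkl]
  ring

theorem relayReceived_congr (c : Code R n) (h : Fin 3 → ℝ) {ω ω' : Messages R n × Noise n}
    (hm : ω.1 = ω'.1) (hU : ω.2.2 = ω'.2.2) (i : Fin n) (hz : ∀ t < i, ω.2.1 t = ω'.2.1 t) :
    ∀ t < i, c.relayReceived h ω t = c.relayReceived h ω' t := by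
  intro t
  induction t using WellFoundedLT.induction with
  | _ t ih =>
    intro hti
    have hpast : (fun s : Fin (t : ℕ) => c.relayReceived h ω ⟨s, s.isLt.trans t.isLt⟩)
        = fun s : Fin (t : ℕ) => c.relayReceived h ω' ⟨s, s.isLt.trans t.isLt⟩ :=
      funext fun s => ih _ s.isLt (lt_trans (Fin.mk_lt_of_lt_val s.isLt) hti)
    rw [relayReceived_eq, relayReceived_eq, hz t hti]
    simp only [userInput_eq_inputOf, hm, hU, hpast]

/-- Causality: the relay noise at time `i` or later cannot influence the inputs at time `i`. -/
theorem userInput_congr (c : Code R n) (h : Fin 3 → ℝ) {ω ω' : Messages R n × Noise n}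
    (hm : ω.1 = ω'.1) (hU : ω.2.2 = ω'.2.2) (i : Fin n) (hz : ∀ t < i, ω.2.1 t = ω'.2.1 t)
    (j : Fin 3) : c.userInput h j i ω = c.userInput h j i ω' := by
  have hpast : (fun s : Fin (i : ℕ) => c.relayReceived h ω ⟨s, s.isLt.trans i.isLt⟩)
      = fun s : Fin (i : ℕ) => c.relayReceived h ω' ⟨s, s.isLt.trans i.isLt⟩ :=
    funext fun s => relayReceived_congr c h hm hU i hz _ (Fin.mk_lt_of_lt_val s.isLt)
  rw [userInput_eq_inputOf, userInput_eq_inputOf, hm, hU, hpast]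

end Replay

/-! ### Measurability -/

section Measurability

theorem measurable_inputOf (c : Code R n) (h : Fin 3 → ℝ) (j : Fin 3) (w : OutMessages R n j)
    (i : Fin n) {α : Type*} [MeasurableSpace α] {zU : α → Fin 3 → Fin n → ℝ}
    {p : α → Fin (i : ℕ) → ℝ} (hz : Measurable zU) (hp : Measurable p) :
    Measurable fun x => c.inputOf h j w (zU x) i (p x) := by
  refine (c.measurable_enc j i w).comp (measurable_pi_lambda _ fun t => ?_)
  refine (measurable_const.mul ((c.measurable_relay _).comp
    (measurable_pi_lambda _ fun s => ?_))).add ?_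
  · exact (measurable_pi_apply _).comp hp
  · exact (measurable_pi_apply _).comp ((measurable_pi_apply j).comp hz)

theorem measurable_userReceived (c : Code R n) (h : Fin 3 → ℝ) (j : Fin 3) {α : Type*}
    [MeasurableSpace α] {zU : α → Fin 3 → Fin n → ℝ} {y : α → Fin n → ℝ} (hz : Measurable zU)
    (hy : Measurable y) : Measurable fun x => c.userReceived h j (zU x) (y x) := by
  refine measurable_pi_lambda _ fun i => ?_
  refine (measurable_const.mul ((c.measurable_relay _).comp
    (measurable_pi_lambda _ fun s => ?_))).add ?_
  · exact (measurable_pi_apply _).comp hy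
  · exact (measurable_pi_apply _).comp ((measurable_pi_apply j).comp hz)

theorem measurable_relayReceived (c : Code R n) (h : Fin 3 → ℝ) :
    Measurable (c.relayReceived h) := by
  refine measurable_from_prod_countable_right fun m => measurable_pi_lambda _ fun i => ?_
  induction i using WellFoundedLT.induction with
  | _ i ih =>
    have hrec : (fun x : Noise n => c.relayReceived h (m, x) i) = fun x =>
        ∑ j, h j * c.inputOf h j (outgoing m j) x.2 i
          (fun t => c.relayReceived h (m, x) ⟨t, t.isLt.trans i.isLt⟩) + x.1 i := by
      funext x
      rw [relayReceived_eq]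
      simp only [userInput_eq_inputOf]
    rw [hrec]
    refine (Finset.measurable_sum _ fun j _ => measurable_const.mul ?_).add
      ((measurable_pi_apply i).comp measurable_fst)
    exact c.measurable_inputOf h j _ i measurable_snd
      (measurable_pi_lambda _ fun t => ih _ t.isLt)

theorem measurable_userInput (c : Code R n) (h : Fin 3 → ℝ) (j : Fin 3) (i : Fin n) :
    Measurable (c.userInput h j i) := by
  refine measurable_from_prod_countable_right fun m => ?_
  simp only [userInput_eq_inputOf]
  exact c.measurable_inputOf h j _ i measurable_snd (measurable_pi_lambda _ fun t =>
    (measurable_pi_apply _).comp ((c.measurable_relayReceived h).comp measurable_prodMk_left))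

/-- The event that user `j` decodes both messages intended for it correctly. -/
def correctAt (c : Code R n) (h : Fin 3 → ℝ) (j : Fin 3) : Set (Messages R n × Noise n) :=
  {ω | c.dec j (c.userReceived h j ω.2.2 (c.relayReceived h ω)) (outgoing ω.1 j)
    = incoming ω.1 j}

theorem measurableSet_correctAt (c : Code R n) (h : Fin 3 → ℝ) (j : Fin 3) :
    MeasurableSet (c.correctAt h j) := by
  have : Measurable fun ω : Messages R n × Noise n =>
      (c.dec j (c.userReceived h j ω.2.2 (c.relayReceived h ω)) (outgoing ω.1 j),
        incoming ω.1 j) := by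
    refine measurable_from_prod_countable_right fun m => ?_
    refine ((c.measurable_dec j (outgoing m j)).comp (c.measurable_userReceived h j
      measurable_snd ((c.measurable_relayReceived h).comp measurable_prodMk_left))).prodMk
      (measurable_const (a := incoming m j))
  exact this (Set.toFinite {x : InMessages R n j × InMessages R n j | x.1 = x.2}).measurableSet

theorem compl_errorEvent_subset (c : Code R n) (h : Fin 3 → ℝ) (j l : Fin 3) :
    (c.errorEvent h)ᶜ ⊆ c.correctAt h j ∩ c.correctAt h l := by
  intro ω hω
  simp only [errorEvent, Set.mem_compl_iff, Set.mem_ofPred_eq, not_exists, not_not,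
    received_snd] at hω
  exact ⟨hω j, hω l⟩

end Measurability

end Code

/-! ### The joint law of messages and noise -/

section JointMeasure

variable {R : Link → ℝ} {n : ℕ}

instance : IsProbabilityMeasure (noiseMeasure n) := by
  unfold noiseMeasure
  infer_instance

instance [Nonempty (Messages R n)] : IsProbabilityMeasure (jointMeasure R n) := by
  have : IsProbabilityMeasure (uniformOn (Set.univ : Set (Messages R n))) :=
    isProbabilityMeasure_uniformOn Set.finite_univ Set.univ_nonempty
  unfold jointMeasure
  infer_instance

/-- The users' noise is integrated last: the change of measure acts on the relay noise alone, and
the count of decodable messages is made with the users' noise fixed. -/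
theorem lintegral_jointMeasure {G : Messages R n × Noise n → ℝ≥0∞} (hG : Measurable G) :
    ∫⁻ ω, G ω ∂(jointMeasure R n) = (Fintype.card (Messages R n) : ℝ≥0∞)⁻¹ *
      ∫⁻ zU, ∑ m, ∫⁻ z, G (m, z, zU) ∂(Measure.pi fun _ : Fin n => gaussianReal 0 1)
        ∂(Measure.pi fun _ : Fin 3 => Measure.pi fun _ : Fin n => gaussianReal 0 1) := by
  have hGm : ∀ m, Measurable fun x : Noise n => G (m, x) := fun m => hG.comp measurable_prodMk_left
  rw [jointMeasure, lintegral_prod _ hG.aemeasurable, uniformOn, ProbabilityTheory.cond,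
    lintegral_smul_measure, Measure.restrict_univ, lintegral_count, tsum_fintype,
    lintegral_finsetSum _ fun m _ => (hGm m).lintegral_prod_left', smul_eq_mul]
  congr 1
  · rw [Measure.count_univ, ENat.card_eq_coe_fintype_card]
    rfl
  · refine Finset.sum_congr rfl fun m _ => ?_
    rw [noiseMeasure, lintegral_prod_symm' _ (hGm m)]

/-- The sign change of the relay noise at time `i`. -/
def flipNoise (i : Fin n) (ω : Messages R n × Noise n) : Messages R n × Noise n :=
  (ω.1, (fun t => (if t = i then (fun x : ℝ => -x) else id) (ω.2.1 t)), ω.2.2)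

theorem measurePreserving_flipNoise [Nonempty (Messages R n)] (i : Fin n) :
    MeasurePreserving (flipNoise i) (jointMeasure R n) (jointMeasure R n) := by
  have : IsProbabilityMeasure (uniformOn (Set.univ : Set (Messages R n))) :=
    isProbabilityMeasure_uniformOn Set.finite_univ Set.univ_nonempty
  have h1 : MeasurePreserving (fun (z : Fin n → ℝ) t => (if t = i then (fun x : ℝ => -x) else id) (z t))
      (Measure.pi fun _ => gaussianReal 0 1) (Measure.pi fun _ => gaussianReal 0 1) := by
    refine measurePreserving_pi _ _ fun t => ?_
    split_ifs
    · exact ⟨measurable_neg, by rw [gaussianReal_map_neg, neg_zero]⟩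
    · exact MeasurePreserving.id _
  exact (MeasurePreserving.id _).prod (h1.prod (MeasurePreserving.id _))

theorem measurePreserving_relayNoise [Nonempty (Messages R n)] (i : Fin n) :
    MeasurePreserving (fun ω : Messages R n × Noise n => ω.2.1 i) (jointMeasure R n)
      (gaussianReal 0 1) := by
  have : IsProbabilityMeasure (uniformOn (Set.univ : Set (Messages R n))) :=
    isProbabilityMeasure_uniformOn Set.finite_univ Set.univ_nonempty
  have h3 : MeasurePreserving Prod.snd (jointMeasure R n) (noiseMeasure n) :=
    measurePreserving_snd
  have h2 : MeasurePreserving Prod.fst (noiseMeasure n)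
      (Measure.pi fun _ : Fin n => gaussianReal 0 1) := measurePreserving_fst
  exact (measurePreserving_eval _ i).comp (h2.comp h3)

theorem memLp_relayNoise [Nonempty (Messages R n)] (i : Fin n) :
    MemLp (fun ω : Messages R n × Noise n => ω.2.1 i) 2 (jointMeasure R n) :=
  (memLp_id_gaussianReal 2).comp_measurePreserving (measurePreserving_relayNoise i)

theorem integral_relayNoise_sq [Nonempty (Messages R n)] (i : Fin n) :
    ∫ ω : Messages R n × Noise n, ω.2.1 i ^ 2 ∂(jointMeasure R n) = 1 := by
  have h1 := (measurePreserving_relayNoise (R := R) i)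
  have h2 : ∫ x, x ^ 2 ∂(gaussianReal 0 1) = 1 := by
    have := variance_fun_id_gaussianReal (μ := 0) (v := 1)
    rw [variance_of_integral_eq_zero aemeasurable_id' integral_id_gaussianReal] at this
    simpa using this
  rw [← h2, ← h1.map_eq, integral_map h1.aemeasurable (by fun_prop)]

end JointMeasure

/-! ### The mean log-likelihood ratio -/

namespace Code

variable {R : Link → ℝ} {n : ℕ}

/-- The log-likelihood ratio of the channel to the channel in which the relay receives, instead of
the signals of users `k` and `l` and its own noise, Gaussian noise of variance `v`. -/
noncomputable def logLikelihood (c : Code R n) (h : Fin 3 → ℝ) (v : ℝ≥0) (k l : Fin 3)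
    (ω : Messages R n × Noise n) : ℝ :=
  ∑ i, logRatio v (ω.2.1 i) (h k * c.userInput h k i ω + h l * c.userInput h l i ω + ω.2.1 i)

section Energy

theorem memLp_userInput (c : Code R n) (h : Fin 3 → ℝ) (j : Fin 3) (i : Fin n)
    (hint : Integrable (fun ω => c.userInput h j i ω ^ 2) (jointMeasure R n)) :
    MemLp (c.userInput h j i) 2 (jointMeasure R n) :=
  (memLp_two_iff_integrable_sq (c.measurable_userInput h j i).aestronglyMeasurable).2 hint

variable [Nonempty (Messages R n)]

/-- Flipping the sign of the relay noise at time `i` preserves the law and, by causality, the input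
at time `i`, but negates the product. -/
theorem integral_userInput_mul_relayNoise (c : Code R n) (h : Fin 3 → ℝ) (j : Fin 3) (i : Fin n) :
    ∫ ω, c.userInput h j i ω * ω.2.1 i ∂(jointMeasure R n) = 0 := by
  have hmp := measurePreserving_flipNoise (R := R) i
  have hm : Measurable fun ω : Messages R n × Noise n => c.userInput h j i ω * ω.2.1 i :=
    (c.measurable_userInput h j i).mul
      ((measurable_pi_apply i).comp (measurable_fst.comp measurable_snd))
  have h1 : ∫ ω, c.userInput h j i ω * ω.2.1 i ∂(jointMeasure R n)
      = ∫ ω, c.userInput h j i (flipNoise i ω) * (flipNoise i ω).2.1 i ∂(jointMeasure R n) := by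
    conv_lhs => rw [← hmp.map_eq]
    exact integral_map hmp.aemeasurable hm.aestronglyMeasurable
  have h2 : ∀ ω : Messages R n × Noise n,
      c.userInput h j i (flipNoise i ω) * (flipNoise i ω).2.1 i
        = -(c.userInput h j i ω * ω.2.1 i) := by
    intro ω
    have h3 : c.userInput h j i (flipNoise i ω) = c.userInput h j i ω :=
      c.userInput_congr h (ω := flipNoise i ω) (ω' := ω) rfl rfl i
        (fun t ht => by simp [flipNoise, ht.ne]) j
    have h4 : (flipNoise i ω).2.1 i = -ω.2.1 i := by simp [flipNoise]
    rw [h3, h4]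
    ring
  simp_rw [h2] at h1
  rw [integral_neg] at h1
  linarith

theorem integrable_logRatio (c : Code R n) (h : Fin 3 → ℝ) (v : ℝ≥0) (k l : Fin 3) (i : Fin n)
    (hk : MemLp (c.userInput h k i) 2 (jointMeasure R n))
    (hl : MemLp (c.userInput h l i) 2 (jointMeasure R n)) :
    Integrable (fun ω => logRatio v (ω.2.1 i)
      (h k * c.userInput h k i ω + h l * c.userInput h l i ω + ω.2.1 i)) (jointMeasure R n) := by
  have hz := memLp_relayNoise (R := R) i
  have hw := ((hk.const_mul (h k)).add (hl.const_mul (h l))).add hz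
  exact ((hz.integrable_sq.neg.div_const 2).add (integrable_const _)).add
    (hw.integrable_sq.div_const _)

theorem integral_logRatio_le (c : Code R n) (h : Fin 3 → ℝ) {v : ℝ≥0} (hv : v ≠ 0) (k l : Fin 3)
    (i : Fin n) (hk : MemLp (c.userInput h k i) 2 (jointMeasure R n))
    (hl : MemLp (c.userInput h l i) 2 (jointMeasure R n)) :
    ∫ ω, logRatio v (ω.2.1 i)
        (h k * c.userInput h k i ω + h l * c.userInput h l i ω + ω.2.1 i) ∂(jointMeasure R n)
      ≤ -1 / 2 + 1 / 2 * Real.log v +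
        ((|h k| + |h l|) * (|h k| * ∫ ω, c.userInput h k i ω ^ 2 ∂(jointMeasure R n)
          + |h l| * ∫ ω, c.userInput h l i ω ^ 2 ∂(jointMeasure R n)) + 1) / (2 * v) := by
  have hv' : (0 : ℝ) < v := by positivity
  have hz := memLp_relayNoise (R := R) i
  have hkz : Integrable (fun ω => c.userInput h k i ω * ω.2.1 i) (jointMeasure R n) :=
    hk.integrable_mul hz
  have hlz : Integrable (fun ω => c.userInput h l i ω * ω.2.1 i) (jointMeasure R n) :=
    hl.integrable_mul hz
  have hk2 := hk.integrable_sq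
  have hl2 := hl.integrable_sq
  have hz2 := hz.integrable_sq
  have hpt : ∀ ω : Messages R n × Noise n, logRatio v (ω.2.1 i)
      (h k * c.userInput h k i ω + h l * c.userInput h l i ω + ω.2.1 i)
      ≤ (1 / (2 * v) - 1 / 2) * ω.2.1 i ^ 2 + 1 / 2 * Real.log v
        + (|h k| + |h l|) * |h k| / (2 * v) * c.userInput h k i ω ^ 2
        + (|h k| + |h l|) * |h l| / (2 * v) * c.userInput h l i ω ^ 2
        + h k / v * (c.userInput h k i ω * ω.2.1 i)
        + h l / v * (c.userInput h l i ω * ω.2.1 i) := by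
    intro ω
    -- Cauchy–Schwarz with weights `|h k|`, `|h l|`. Feedback may correlate the two inputs, so their
    -- cross term cannot be dropped; this is the source of `(|h_k| + |h_l|)^2`.
    have hcs : (h k * c.userInput h k i ω + h l * c.userInput h l i ω) ^ 2
        ≤ (|h k| + |h l|) * (|h k| * c.userInput h k i ω ^ 2 + |h l| * c.userInput h l i ω ^ 2) := by
      generalize c.userInput h k i ω = x
      generalize c.userInput h l i ω = y
      have h1 : 2 * (h k * x) * (h l * y) ≤ |h k| * |h l| * (x ^ 2 + y ^ 2) := by
        have h2 : (h k * x) * (h l * y) ≤ |h k| * |h l| * (|x| * |y|) := by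
          refine (le_abs_self _).trans_eq ?_
          simp only [abs_mul]
          ring
        have h3 : 2 * (|x| * |y|) ≤ x ^ 2 + y ^ 2 := by
          nlinarith [sq_nonneg (|x| - |y|), sq_abs x, sq_abs y]
        nlinarith [mul_le_mul_of_nonneg_left h3 (mul_nonneg (abs_nonneg (h k)) (abs_nonneg (h l)))]
      nlinarith [sq_abs (h k), sq_abs (h l)]
    have hdiv := div_le_div_of_nonneg_right hcs (by positivity : (0 : ℝ) ≤ 2 * v)
    have hexpand : logRatio v (ω.2.1 i)
        (h k * c.userInput h k i ω + h l * c.userInput h l i ω + ω.2.1 i)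
        = (1 / (2 * v) - 1 / 2) * ω.2.1 i ^ 2 + 1 / 2 * Real.log v
          + (h k * c.userInput h k i ω + h l * c.userInput h l i ω) ^ 2 / (2 * v)
          + h k / v * (c.userInput h k i ω * ω.2.1 i)
          + h l / v * (c.userInput h l i ω * ω.2.1 i) := by
      unfold logRatio
      field_simp
      ring
    have hsplit : (|h k| + |h l|) * (|h k| * c.userInput h k i ω ^ 2
        + |h l| * c.userInput h l i ω ^ 2) / (2 * v)
        = (|h k| + |h l|) * |h k| / (2 * v) * c.userInput h k i ω ^ 2
        + (|h k| + |h l|) * |h l| / (2 * v) * c.userInput h l i ω ^ 2 := by ring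
    rw [hexpand]
    linarith
  have i1 := hz2.const_mul (1 / (2 * v) - 1 / 2 : ℝ)
  have i2 := i1.add (integrable_const (1 / 2 * Real.log v))
  have i3 := i2.add (hk2.const_mul ((|h k| + |h l|) * |h k| / (2 * v)))
  have i4 := i3.add (hl2.const_mul ((|h k| + |h l|) * |h l| / (2 * v)))
  have i5 := i4.add (hkz.const_mul (h k / v))
  have i6 := i5.add (hlz.const_mul (h l / v))
  refine (integral_mono (c.integrable_logRatio h v k l i hk hl) i6 hpt).trans_eq ?_
  rw [integral_add' i5 (hlz.const_mul _), integral_add' i4 (hkz.const_mul _),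
    integral_add' i3 (hl2.const_mul _), integral_add' i2 (hk2.const_mul _),
    integral_add' i1 (integrable_const _)]
  simp only [integral_const_mul, integral_userInput_mul_relayNoise, integral_relayNoise_sq,
    integral_const, probReal_univ, one_smul]
  field_simp
  ring

theorem integrable_logLikelihood (c : Code R n) (h : Fin 3 → ℝ) (v : ℝ≥0) (k l : Fin 3)
    {P Pr : ℝ} (hP : c.SatisfiesPower h P Pr) :
    Integrable (c.logLikelihood h v k l) (jointMeasure R n) :=
  integrable_finsetSum _ fun i _ => c.integrable_logRatio h v k l i
    (c.memLp_userInput h k i ((hP.1 k).1 i)) (c.memLp_userInput h l i ((hP.1 l).1 i))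

/-- As `v` is the largest average power allowed for the two signals plus noise, the quadratic term
is at most `n v / (2 v) = n / 2`, which cancels the `-n / 2` from the noise. -/
theorem integral_logLikelihood_le (c : Code R n) (h : Fin 3 → ℝ) {v : ℝ≥0} (k l : Fin 3)
    {P Pr : ℝ} (hP : c.SatisfiesPower h P Pr) (hv : (v : ℝ) = 1 + (|h k| + |h l|) ^ 2 * P)
    (hv0 : v ≠ 0) (hn : 0 < n) :
    ∫ ω, c.logLikelihood h v k l ω ∂(jointMeasure R n) ≤ n * (1 / 2 * Real.log v) := by
  have hv' : (0 : ℝ) < v := by positivity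
  have hn' : (0 : ℝ) < n := by exact_mod_cast hn
  have hsum : ∀ j, ∑ i, ∫ ω, c.userInput h j i ω ^ 2 ∂(jointMeasure R n) ≤ n * P := by
    intro j
    have := (hP.1 j).2
    rwa [one_div, inv_mul_le_iff₀ hn'] at this
  unfold logLikelihood
  rw [integral_finsetSum _ fun i _ => c.integrable_logRatio h v k l i
    (c.memLp_userInput h k i ((hP.1 k).1 i)) (c.memLp_userInput h l i ((hP.1 l).1 i))]
  refine (Finset.sum_le_sum fun i _ => c.integral_logRatio_le h hv0 k l i
    (c.memLp_userInput h k i ((hP.1 k).1 i)) (c.memLp_userInput h l i ((hP.1 l).1 i))).trans ?_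
  simp only [Finset.sum_add_distrib, ← Finset.sum_div, ← Finset.mul_sum, Finset.sum_const,
    Finset.card_univ, Fintype.card_fin, nsmul_eq_mul, mul_one]
  have hb : (|h k| + |h l|) * (|h k| * ∑ i, ∫ ω, c.userInput h k i ω ^ 2 ∂(jointMeasure R n)
      + |h l| * ∑ i, ∫ ω, c.userInput h l i ω ^ 2 ∂(jointMeasure R n)) + n ≤ n * v := by
    have h1 : |h k| * ∑ i, ∫ ω, c.userInput h k i ω ^ 2 ∂(jointMeasure R n)
      + |h l| * ∑ i, ∫ ω, c.userInput h l i ω ^ 2 ∂(jointMeasure R n)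
      ≤ |h k| * (n * P) + |h l| * (n * P) := by
      gcongr
      · exact hsum k
      · exact hsum l
    have h2 := mul_le_mul_of_nonneg_left h1 (add_nonneg (abs_nonneg (h k)) (abs_nonneg (h l)))
    rw [hv]
    linarith
  have hd := div_le_div_of_nonneg_right hb (by positivity : (0 : ℝ) ≤ 2 * v)
  have he : n * (v : ℝ) / (2 * v) = n / 2 := by field_simp
  rw [he] at hd
  linarith

end Energy

/-! ### Weights under the reference law -/

section Likelihood

theorem logLikelihood_eq_sum_shear (c : Code R n) (h : Fin 3 → ℝ) (v : ℝ≥0) {j k l : Fin 3}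
    (hkj : k ≠ j) (hlj : l ≠ j) (hkl : k ≠ l) (ω : Messages R n × Noise n) :
    c.logLikelihood h v k l ω = ∑ i, logRatio v (ω.2.1 i)
      (shear (fun i p => h j * c.inputOf h j (outgoing ω.1 j) ω.2.2 i p)
        (c.relayReceived h ω) i) := by
  simp only [logLikelihood, c.shear_inputOf h ω hkj hlj hkl]

theorem measurable_logLikelihood (c : Code R n) (h : Fin 3 → ℝ) (v : ℝ≥0) (k l : Fin 3) :
    Measurable (c.logLikelihood h v k l) := by
  refine Finset.measurable_sum _ fun i _ => ?_
  have h1 := c.measurable_userInput h k i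
  have h2 := c.measurable_userInput h l i
  have h3 : Measurable fun ω : Messages R n × Noise n => ω.2.1 i :=
    (measurable_pi_apply i).comp (measurable_fst.comp measurable_snd)
  unfold logRatio
  fun_prop

/-- Here `s m` is the side information. By `hs` it fixes the messages of user `j`, hence the
reference density of `y` for given users' noise. -/
theorem lintegral_mul_exp_neg_logLikelihood_le [Nonempty (Messages R n)] (c : Code R n)
    (h : Fin 3 → ℝ) {v : ℝ≥0} (hv : v ≠ 0) {j k l : Fin 3} (hkj : k ≠ j) (hlj : l ≠ j)
    (hkl : k ≠ l) {σ : Type*} [Fintype σ] [DecidableEq σ] (s : Messages R n → σ)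
    (out : σ → OutMessages R n j) (hs : ∀ m, out (s m) = outgoing m j)
    (F : Messages R n → (Fin 3 → Fin n → ℝ) → (Fin n → ℝ) → ℝ≥0∞)
    (hF : ∀ m zU, Measurable (F m zU))
    (hFm : Measurable fun ω : Messages R n × Noise n => F ω.1 ω.2.2 (c.relayReceived h ω))
    (hF1 : ∀ zU t y, ∑ m with s m = t, F m zU y ≤ 1) :
    ∫⁻ ω, F ω.1 ω.2.2 (c.relayReceived h ω) *
        ENNReal.ofReal (Real.exp (-c.logLikelihood h v k l ω)) ∂(jointMeasure R n)
      ≤ (Fintype.card (Messages R n) : ℝ≥0∞)⁻¹ * Fintype.card σ := by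
  have hm : Measurable fun ω => F ω.1 ω.2.2 (c.relayReceived h ω) *
      ENNReal.ofReal (Real.exp (-c.logLikelihood h v k l ω)) :=
    hFm.mul (Real.measurable_exp.comp (c.measurable_logLikelihood h v k l).neg).ennreal_ofReal
  rw [lintegral_jointMeasure hm]
  gcongr
  calc _ ≤ ∫⁻ _, (Fintype.card σ : ℝ≥0∞)
        ∂(Measure.pi fun _ : Fin 3 => Measure.pi fun _ : Fin n => gaussianReal 0 1) := by
        refine lintegral_mono fun zU => ?_
        have key := sum_lintegral_comp_mul_exp_neg_logRatio_le hv s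
          (a := fun m => c.relaySignal h m zU) (b := fun t i p => h j * c.inputOf h j (out t) zU i p)
          (fun m i => Finset.measurable_sum _ fun j _ => measurable_const.mul
            (c.measurable_inputOf h j _ i measurable_const measurable_id))
          (fun t i => measurable_const.mul
            (c.measurable_inputOf h j _ i measurable_const measurable_id))
          (S := fun m z => c.relayReceived h (m, z, zU))
          (fun m => (c.measurable_relayReceived h).comp
            (measurable_prodMk_left.comp measurable_prodMk_right))
          (fun m z => c.shear_relaySignal h (m, z, zU)) (hF := fun m => hF m zU) (hF1 zU)
        refine le_trans (le_of_eq ?_) key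
        refine Finset.sum_congr rfl fun m _ => lintegral_congr fun z => ?_
        rw [c.logLikelihood_eq_sum_shear h v hkj hlj hkl, hs]
    _ = _ := by simp

end Likelihood

end Code

/-! ### Counting messages -/

section Counting

variable {R : Link → ℝ} {n : ℕ}

theorem half_le_natFloor {x : ℝ} (hx : 1 ≤ x) : x / 2 ≤ (⌊x⌋₊ : ℝ) := by
  have h1 : (1 : ℝ) ≤ (⌊x⌋₊ : ℝ) := by exact_mod_cast (Nat.one_le_floor_iff x).2 hx
  have h2 := Nat.lt_floor_add_one x
  linarith

theorem one_le_two_rpow_mul {p : Link} (hR : 0 ≤ R p) : (1 : ℝ) ≤ 2 ^ ((n : ℝ) * R p) :=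
  Real.one_le_rpow one_le_two (by positivity)

theorem one_le_messageCount {p : Link} (hR : 0 ≤ R p) : 1 ≤ messageCount R n p :=
  (Nat.one_le_floor_iff _).2 (one_le_two_rpow_mul hR)

/-- Rounding down loses at most a factor of two, that is, one bit per message. -/
theorem log_messageCount_ge {p : Link} (hR : 0 ≤ R p) :
    (n * R p - 1) * Real.log 2 ≤ Real.log (messageCount R n p) := by
  have h1 := half_le_natFloor (one_le_two_rpow_mul (n := n) hR)
  have h2 : (0 : ℝ) < 2 ^ ((n : ℝ) * R p) := by positivity
  refine le_trans (le_of_eq ?_) (Real.log_le_log (by positivity) h1)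
  rw [Real.log_div h2.ne' two_ne_zero, Real.log_rpow two_pos]
  ring

theorem card_messages_eq (T : Finset Link) :
    Fintype.card (Messages R n)
      = (∏ p ∈ T, messageCount R n p) *
        Fintype.card ((p : {p : Link // p ∉ T}) → Fin (messageCount R n p)) := by
  simp only [Fintype.card_pi, Fintype.card_fin]
  rw [← Fintype.prod_subtype_mul_prod_subtype (fun p => p ∈ T)]
  congr 1
  convert Finset.prod_coe_sort T fun p => messageCount R n p

theorem outgoing_eq_of_forall {m m' : Messages R n} {j : Fin 3}
    (hm : ∀ k (hk : j ≠ k), m (link j k hk) = m' (link j k hk)) : outgoing m j = outgoing m' j :=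
  funext fun k => hm k k.2.symm

/-- Two message tuples for which the receivers `j` and `l` make the same decisions when given the
same outgoing messages are equal if they agree outside the links `k → j`, `l → j`, `k → l`. -/
theorem messages_eq_of_decoded {j k l : Fin 3} (hkj : k ≠ j) (hlj : l ≠ j) (hkl : k ≠ l)
    {dj : OutMessages R n j → InMessages R n j} {dl : OutMessages R n l → InMessages R n l}
    {m m' : Messages R n} (hj : dj (outgoing m j) = incoming m j)
    (hj' : dj (outgoing m' j) = incoming m' j) (hl : dl (outgoing m l) = incoming m l)
    (hl' : dl (outgoing m' l) = incoming m' l)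
    (hmm : ∀ p ∉ ({link k j hkj, link l j hlj, link k l hkl} : Finset Link), m p = m' p) :
    m = m' := by
  have hout : outgoing m j = outgoing m' j := outgoing_eq_of_forall fun i hi => hmm _ (by
    simp [link, hkj.symm, hlj.symm])
  have hin : incoming m j = incoming m' j := by rw [← hj, ← hj', hout]
  have hkj' : m (link k j hkj) = m' (link k j hkj) := congrFun hin ⟨k, hkj⟩
  have hlj' : m (link l j hlj) = m' (link l j hlj) := congrFun hin ⟨l, hlj⟩
  -- The message from `l` to `j` has just been recovered at `j`; the other message of `l`, to `k`,
  -- lies outside the three links.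
  have houtl : outgoing m l = outgoing m' l := outgoing_eq_of_forall fun i hi => by
    by_cases hij : i = j
    · subst hij
      exact hlj'
    · exact hmm _ (by simp [link, hij, hkl.symm])
  have hinl : incoming m l = incoming m' l := by rw [← hl, ← hl', houtl]
  have hkl' : m (link k l hkl) = m' (link k l hkl) := congrFun hinl ⟨k, hkl⟩
  funext p
  by_cases hp : p ∈ ({link k j hkj, link l j hlj, link k l hkl} : Finset Link)
  · simp only [Finset.mem_insert, Finset.mem_singleton] at hp
    rcases hp with rfl | rfl | rfl
    exacts [hkj', hlj', hkl']
  · exact hmm p hp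

end Counting

/-! ### The bound at finite length -/

namespace Code

variable {R : Link → ℝ} {n : ℕ}

theorem one_sub_errorProb_mul_log_le (c : Code R n) (h : Fin 3 → ℝ) {P Pr : ℝ} (hP0 : 0 ≤ P)
    (hR : ∀ p, 0 ≤ R p) (hP : c.SatisfiesPower h P Pr) (hn : 0 < n) {j k l : Fin 3} (hkj : k ≠ j)
    (hlj : l ≠ j) (hkl : k ≠ l) :
    (1 - c.errorProb h) * Real.log (messageCount R n (link k j hkj) *
        messageCount R n (link l j hlj) * messageCount R n (link k l hkl))
      ≤ n * (1 / 2 * Real.log (1 + (|h k| + |h l|) ^ 2 * P)) + 1 := by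
  classical
  have hM1 : ∀ p, 1 ≤ messageCount R n p := fun p => one_le_messageCount (hR p)
  have hne : Nonempty (Messages R n) := ⟨fun p => ⟨0, hM1 p⟩⟩
  let v : ℝ≥0 := ⟨1 + (|h k| + |h l|) ^ 2 * P, by positivity⟩
  have hv : (v : ℝ) = 1 + (|h k| + |h l|) ^ 2 * P := rfl
  have hv0 : v ≠ 0 := by
    rw [← NNReal.coe_ne_zero, hv]
    positivity
  let T : Finset Link := {link k j hkj, link l j hlj, link k l hkl}
  have hT : ∏ p ∈ T, messageCount R n p = messageCount R n (link k j hkj) *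
      messageCount R n (link l j hlj) * messageCount R n (link k l hkl) := by
    rw [Finset.prod_insert (by simp [link, hkl, hlj.symm]),
      Finset.prod_pair (by simp [link, hkl.symm]), mul_assoc]
  have hTout : ∀ i (hi : j ≠ i), link j i hi ∉ T := fun i hi => by
    simp [T, link, hkj.symm, hlj.symm]
  have hMpos : 1 ≤ ∏ p ∈ T, messageCount R n p := Finset.one_le_prod' fun p _ => hM1 p
  let F : Messages R n → (Fin 3 → Fin n → ℝ) → (Fin n → ℝ) → ℝ≥0∞ := fun m zU y =>
    if c.dec j (c.userReceived h j zU y) (outgoing m j) = incoming m j ∧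
      c.dec l (c.userReceived h l zU y) (outgoing m l) = incoming m l then 1 else 0
  have hFA : ∀ ω : Messages R n × Noise n, F ω.1 ω.2.2 (c.relayReceived h ω)
      = (c.correctAt h j ∩ c.correctAt h l).indicator 1 ω := fun ω => by
    by_cases hω : ω ∈ c.correctAt h j ∩ c.correctAt h l
    · rw [Set.indicator_of_mem hω]
      exact if_pos hω
    · rw [Set.indicator_of_notMem hω]
      exact if_neg hω
  have hAm : MeasurableSet (c.correctAt h j ∩ c.correctAt h l) :=
    (c.measurableSet_correctAt h j).inter (c.measurableSet_correctAt h l)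
  have hdec : ∀ (i : Fin 3) (m : Messages R n) (zU : Fin 3 → Fin n → ℝ), MeasurableSet
      {y | c.dec i (c.userReceived h i zU y) (outgoing m i) = incoming m i} := fun i m zU =>
    ((c.measurable_dec i (outgoing m i)).comp
      (c.measurable_userReceived h i measurable_const measurable_id)) (measurableSet_singleton _)
  -- With all messages as side information and weight `1`, the reference law has total mass at most
  -- `1`.
  have h1 := c.lintegral_mul_exp_neg_logLikelihood_le h hv0 hkj hlj hkl id
    (fun m => outgoing m j) (fun _ => rfl) (fun _ _ _ => 1) (fun _ _ => measurable_const)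
    measurable_const (fun _ t _ => by simp [Finset.filter_eq'])
  -- With the other three messages as side information, at most one tuple per fibre is decoded
  -- correctly from given `y` and users' noise. This gives mass at most `1/M`.
  have h2 := c.lintegral_mul_exp_neg_logLikelihood_le h hv0 hkj hlj hkl
    (fun m (p : {p : Link // p ∉ T}) => m p)
    (fun t i => t ⟨link j i i.2.symm, hTout i i.2.symm⟩) (fun _ => rfl) F
    (fun m zU => Measurable.ite ((hdec j m zU).inter (hdec l m zU)) measurable_const
      measurable_const)
    (by simp_rw [hFA]; exact measurable_one.indicator hAm)
    (fun zU t y => by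
      simp only [F]
      rw [Finset.sum_boole]
      refine Nat.cast_le_one.2 (Finset.card_le_one.2 fun m hm m' hm' => ?_)
      simp only [Finset.mem_filter, Finset.mem_univ, true_and] at hm hm'
      exact messages_eq_of_decoded hkj hlj hkl hm.2.1 hm'.2.1 hm.2.2 hm'.2.2 fun p hp =>
        congrFun (hm.1.trans hm'.1.symm) ⟨p, hp⟩)
  have hcard0 : (Fintype.card (Messages R n) : ℝ≥0∞) ≠ 0 := by
    exact_mod_cast Fintype.card_ne_zero
  rw [ENNReal.inv_mul_cancel hcard0 (ENNReal.natCast_ne_top _)] at h1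
  simp only [one_mul, hFA] at h1 h2
  have hratio : (Fintype.card (Messages R n) : ℝ≥0∞)⁻¹ *
      Fintype.card ((p : {p : Link // p ∉ T}) → Fin (messageCount R n p))
      = ENNReal.ofReal ((∏ p ∈ T, messageCount R n p : ℕ) : ℝ)⁻¹ := by
    have hc := card_messages_eq (R := R) (n := n) T
    rw [ENNReal.ofReal_inv_of_pos (by exact_mod_cast hMpos), ENNReal.ofReal_natCast]
    rw [hc] at hcard0 ⊢
    rw [Nat.cast_mul] at hcard0 ⊢
    rw [ENNReal.mul_inv (Or.inr (ENNReal.natCast_ne_top _)) (Or.inl (ENNReal.natCast_ne_top _)),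
      mul_assoc, ENNReal.inv_mul_cancel (right_ne_zero_of_mul hcard0) (ENNReal.natCast_ne_top _),
      mul_one]
  rw [hratio] at h2
  have hgibbs := measureReal_mul_log_le (c.integrable_logLikelihood h v k l hP) hAm
    (M := ((∏ p ∈ T, messageCount R n p : ℕ) : ℝ)) (by exact_mod_cast hMpos) h1 h2
  have hlogM : 0 ≤ Real.log ((∏ p ∈ T, messageCount R n p : ℕ) : ℝ) :=
    Real.log_nonneg (by exact_mod_cast hMpos)
  have hprob : 1 - c.errorProb h ≤ (jointMeasure R n).real (c.correctAt h j ∩ c.correctAt h l) := by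
    have hsub : (c.correctAt h j ∩ c.correctAt h l)ᶜ ⊆ c.errorEvent h :=
      Set.compl_subset_comm.1 (c.compl_errorEvent_subset h j l)
    have hle := measureReal_mono (μ := jointMeasure R n) hsub
    rw [probReal_compl_eq_one_sub hAm] at hle
    unfold errorProb
    linarith
  have hL := c.integral_logLikelihood_le h k l hP hv hv0 hn
  rw [hv] at hL
  have := mul_le_mul_of_nonneg_right hprob hlogM
  rw [hT] at this hgibbs
  push_cast at this hgibbs
  linarith

end Code

end YChannel

/-! ### Passage to the limit -/

theorem mainTheorem6 (h : Fin 3 → ℝ) (P Pr : ℝ) (R : YChannel.Link → ℝ)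
    (hR : R ∈ YChannel.capacityRegion h P Pr)
    (j k l : Fin 3) (hkj : k ≠ j) (hlj : l ≠ j) (hkl : k ≠ l) :
    R (YChannel.link k j hkj) + R (YChannel.link l j hlj) + R (YChannel.link k l hkl)
      ≤ YChannel.gaussianC ((|h k| + |h l|) ^ 2 * P) := by
  obtain ⟨hR0, c, hP, herr⟩ := hR
  -- At length `0` the average power is `(1 / 0) * 0 = 0`, so the constraint reads `0 ≤ P`.
  have hP0 : 0 ≤ P := by simpa using ((hP 0).1 0).2
  have hlog2 : 0 < Real.log 2 := Real.log_pos one_lt_two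
  set r := R (YChannel.link k j hkj) + R (YChannel.link l j hlj) + R (YChannel.link k l hkl) with hr
  -- The term `3 / n` is the rounding loss of three messages, and `1 / n` is the additive `1` of the
  -- Gibbs inequality.
  have hbound : ∀ᶠ n : ℕ in atTop, (1 - (c n).errorProb h) * ((r - 3 / n) * Real.log 2)
      ≤ 1 / 2 * Real.log (1 + (|h k| + |h l|) ^ 2 * P) + 1 / n := by
    filter_upwards [eventually_gt_atTop 0, herr.eventually_le_const one_pos] with n hn he
    have hn' : (0 : ℝ) < n := by exact_mod_cast hn
    have hmain := (c n).one_sub_errorProb_mul_log_le h hP0 hR0 (hP n) hn hkj hlj hkl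
    have hpos : ∀ p, (YChannel.messageCount R n p : ℝ) ≠ 0 := fun p => by
      exact_mod_cast Nat.one_le_iff_ne_zero.1 (YChannel.one_le_messageCount (hR0 p))
    rw [Real.log_mul (mul_ne_zero (hpos _) (hpos _)) (hpos _), Real.log_mul (hpos _) (hpos _)]
      at hmain
    have h1 := YChannel.log_messageCount_ge (n := n) (hR0 (YChannel.link k j hkj))
    have h2 := YChannel.log_messageCount_ge (n := n) (hR0 (YChannel.link l j hlj))
    have h3 := YChannel.log_messageCount_ge (n := n) (hR0 (YChannel.link k l hkl))
    have h4 : (n * r - 3) * Real.log 2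
        ≤ Real.log (YChannel.messageCount R n (YChannel.link k j hkj))
          + Real.log (YChannel.messageCount R n (YChannel.link l j hlj))
          + Real.log (YChannel.messageCount R n (YChannel.link k l hkl)) := by
      rw [hr]
      linarith
    have h5 := (mul_le_mul_of_nonneg_left h4 (sub_nonneg.2 he)).trans hmain
    have h6 := div_le_div_of_nonneg_right h5 hn'.le
    have e1 : (1 - (c n).errorProb h) * ((n * r - 3) * Real.log 2) / n
        = (1 - (c n).errorProb h) * ((r - 3 / n) * Real.log 2) := by
      field_simp
    have e2 : (n * (1 / 2 * Real.log (1 + (|h k| + |h l|) ^ 2 * P)) + 1) / n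
        = 1 / 2 * Real.log (1 + (|h k| + |h l|) ^ 2 * P) + 1 / n := by
      field_simp
    rwa [e1, e2] at h6
  have hl : Tendsto (fun n : ℕ => (1 - (c n).errorProb h) * ((r - 3 / n) * Real.log 2)) atTop
      (𝓝 ((1 - 0) * ((r - 0) * Real.log 2))) :=
    (tendsto_const_nhds.sub herr).mul
      ((tendsto_const_nhds.sub (tendsto_const_div_atTop_nhds_zero_nat 3)).mul_const _)
  have hrt : Tendsto (fun n : ℕ => 1 / 2 * Real.log (1 + (|h k| + |h l|) ^ 2 * P) + 1 / (n : ℝ))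
      atTop (𝓝 (1 / 2 * Real.log (1 + (|h k| + |h l|) ^ 2 * P) + 0)) :=
    tendsto_const_nhds.add (tendsto_const_div_atTop_nhds_zero_nat 1)
  have hfin := le_of_tendsto_of_tendsto hl hrt hbound
  rw [YChannel.gaussianC, Real.logb, ← mul_div_assoc, le_div_iff₀ hlog2]
  linarith
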